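/- Fix an integer $k \ge 2$. For $1 \le i \le k$ define the formal power series in $q$ (over $\mathbb{C}$) $$G_i = \prod_{n \ge 1,\ n \not\equiv 0,\ \pm(k+1-i) \ (\mathrm{mod}\ 2k+1)} \frac{1}{1-q^n},$$ and for $j \ge 1$ and $2 \le i \le k$ define recursively the formal (Laurent) series $$G_{(k-1)j+i} = \frac{G_{(k-1)(j-1)+k-i+1} - G_{(k-1)(j-1)+k-i+2}}{q^{(i-1)j}},$$ so that $G_s$ is defined for all $s \ge 1$. A partition $m = p_1 + \cdots + p_n$ of an integer $m \ge 0$, with $p_1 \ge \cdots \ge p_n > 0$, is said to have difference at least $2$ at distance $t$ if $p_s - p_{s+t} \ge 2$ whenever $s \ge 1$ and $s+t \le n$. **Theorem.** For all $j \ge 0$ and $1 \le l \le k$, $G_{(k-1)j+l}$ is a formal power series in $q$, and for every $m \ge 0$ its coefficient of $q^m$ is the number of partitions of $m$ with difference at least $2$ at distance $k-1$, with all parts greater than $j$, and in which $j+1$ appears at most $k-l$ times. -/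

import Mathlib

open scoped PowerSeries LaurentSeries PowerSeries.WithPiTopology

namespace Gordon

/-- The residue condition `n ≢ 0, ±(k + 1 - i) (mod 2k + 1)`. -/
def Allowed (k i n : ℕ) : Prop :=
  ¬ (n : ℤ) ≡ 0 [ZMOD (2 * k + 1)] ∧
  ¬ (n : ℤ) ≡ (k + 1 - i : ℤ) [ZMOD (2 * k + 1)] ∧
  ¬ (n : ℤ) ≡ -(k + 1 - i : ℤ) [ZMOD (2 * k + 1)]

instance (k i : ℕ) : DecidablePred (Allowed k i) := fun n => by
  unfold Allowed
  infer_instance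

/-- The factor at `n` of the product below: `1 / (1 - q ^ n)` if `n` is allowed, and `1` if not. -/
noncomputable def factor (k i n : ℕ) : ℂ⟦X⟧ :=
  if Allowed k i n then (1 - PowerSeries.X ^ n)⁻¹ else 1

/-- The formal power series `∏ 1 / (1 - q ^ n)` over all `n ≥ 1` with
`n ≢ 0, ±(k + 1 - i) (mod 2k + 1)`; infinite products of formal power series are taken
coefficientwise, and this one converges (see `multipliable_factor`). -/
noncomputable def product (k i : ℕ) : ℂ⟦X⟧ :=
  ∏' n : ℕ, factor k i (n + 1)

theorem multipliable_factor (k i : ℕ) : Multipliable fun n : ℕ => factor k i (n + 1) := by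
  have h := Nat.Partition.multipliable_powerSeriesMk_card_restricted ℂ (Allowed k i)
  refine h.congr fun n => ?_
  unfold factor
  split_ifs with hn
  · have h0 : PowerSeries.constantCoeff ((PowerSeries.X : ℂ⟦X⟧) ^ (n + 1)) = 0 := by simp
    rw [eq_comm, PowerSeries.inv_eq_iff_mul_eq_one (by simp)]
    simp_rw [pow_mul]
    exact PowerSeries.WithPiTopology.tsum_pow_mul_one_sub_of_constantCoeff_eq_zero h0
  · rfl

/-- The sequence `G_s`, `s ≥ 1`, of formal Laurent series in `q`.
For `1 ≤ s ≤ k` it is the product above. Every `s > k` is uniquely `(k - 1) * j + i` with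
`j ≥ 1` and `2 ≤ i ≤ k`, and then
`G_{(k-1)j+i} = (G_{(k-1)(j-1)+k-i+1} - G_{(k-1)(j-1)+k-i+2}) / q ^ ((i-1)j)`;
see `G_of_le` and `G_rec`. (The values at `s = 0` and for `k ≤ 1` are irrelevant.) -/
noncomputable def G (k s : ℕ) : ℂ⸨X⸩ :=
  if h : s ≤ k ∨ k ≤ 1 then (product k s : ℂ⸨X⸩)
  else
    let j := (s - 2) / (k - 1)
    let i := (s - 2) % (k - 1) + 2
    (G k ((k - 1) * (j - 1) + (k - i) + 1) - G k ((k - 1) * (j - 1) + (k - i) + 2)) /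
      ((PowerSeries.X : ℂ⟦X⟧) : ℂ⸨X⸩) ^ ((i - 1) * j)
termination_by s
decreasing_by
  all_goals
    push Not at h
    have hk : 0 < k - 1 := by omega
    have h1 := Nat.div_add_mod (s - 2) (k - 1)
    have h2 := Nat.mod_lt (s - 2) hk
    have h3 : 1 ≤ (s - 2) / (k - 1) := (Nat.one_le_div_iff hk).2 (by omega)
    have h4 : (k - 1) * ((s - 2) / (k - 1)) =
        (k - 1) * ((s - 2) / (k - 1) - 1) + (k - 1) := by
      conv_lhs => rw [← Nat.sub_add_cancel h3]
      ring
    omega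

theorem G_of_le {k s : ℕ} (hs : s ≤ k) : G k s = (product k s : ℂ⸨X⸩) := by
  rw [G, dif_pos (Or.inl hs)]

theorem G_rec {k j i : ℕ} (hj : 1 ≤ j) (hi : 2 ≤ i) (hik : i ≤ k) :
    G k ((k - 1) * j + i) =
      (G k ((k - 1) * (j - 1) + (k - i) + 1) - G k ((k - 1) * (j - 1) + (k - i) + 2)) /
        ((PowerSeries.X : ℂ⟦X⟧) : ℂ⸨X⸩) ^ ((i - 1) * j) := by
  have hk : 0 < k - 1 := by omega
  have hle : k - 1 ≤ (k - 1) * j := Nat.le_mul_of_pos_right _ hj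
  have e : (k - 1) * j + i - 2 = (i - 2) + (k - 1) * j := by omega
  have hd : ((k - 1) * j + i - 2) / (k - 1) = j := by
    rw [e, Nat.add_mul_div_left _ _ hk, Nat.div_eq_of_lt (by omega), zero_add]
  have hm : ((k - 1) * j + i - 2) % (k - 1) + 2 = i := by
    rw [e, Nat.add_mul_mod_self_left, Nat.mod_eq_of_lt (by omega)]
    omega
  rw [G, dif_neg (by omega)]
  simp only [hd, hm]

/-- The parts `p_1 ≥ p_2 ≥ ⋯ ≥ p_n` of a partition, in nonincreasing order. -/
def sortedParts {m : ℕ} (p : m.Partition) : List ℕ :=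
  p.parts.sort (· ≥ ·)

/-- Parts at distance `t` have difference at least `2`: `p_s - p_{s+t} ≥ 2` whenever both
parts exist. -/
def DiffTwoAtDistance (t : ℕ) {m : ℕ} (p : m.Partition) : Prop :=
  ∀ (s : ℕ) (h : s + t < (sortedParts p).length),
    (sortedParts p)[s + t] + 2 ≤ (sortedParts p)[s]

/-- The number of partitions of `m` with difference at least `2` at distance `k - 1`, with every
part greater than `j`, and in which `j + 1` appears at most `k - l` times. -/
noncomputable def numPartitions (k j l m : ℕ) : ℕ :=
  Nat.card {p : m.Partition //
    DiffTwoAtDistance (k - 1) p ∧ (∀ a ∈ p.parts, j < a) ∧ p.parts.count (j + 1) ≤ k - l}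

end Gordon

/-! Write F(j,i) for `partsGenFun k j i`, where i = k+1-l. Sorting partitions by the multiplicity of
j+1 gives F(j,i+1) = F(j,i) + q^((j+1)i) F(j+1,k-i), which is the recursion of the G's with the
division cleared. So everything reduces to j = 0, that is, to Gordon's identities
`product_eq_partsGenFun`.

For these, multiply by the Euler product. The Jacobi triple product turns the product side into an
alternating series, the case j = 0 of `gordonSum`. For every j these series satisfy the same
recursion, by telescoping (`gordonSum_rec`), and modulo q^(j+1) they agree with the Euler product,
while F(j,i) agrees with 1. Hence the difference of the two solutions is divisible by q^N at level j
= N, and the recursion carries this down to level 0 (`X_pow_dvd_of_rec`). Limits are handled as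
congruences modulo powers of q. -/

namespace Gordon

open Finset

/-! ### Gaussian binomials and the finite triple product. -/

section QBinomial

variable {R : Type*} [CommRing R]

/-- The Gaussian binomial coefficient `[n; s]` at `Q`. -/
def qChoose (Q : R) : ℕ → ℕ → R
  | _, 0 => 1
  | 0, _ + 1 => 0
  | n + 1, s + 1 => qChoose Q n (s + 1) + Q ^ (n - s) * qChoose Q n s

/-- The `q`-factorial `(1 - Q) ⋯ (1 - Q ^ n)`. -/
def qFact (Q : R) (n : ℕ) : R := ∏ i ∈ range n, (1 - Q ^ (i + 1))

theorem qFact_succ (Q : R) (n : ℕ) : qFact Q (n + 1) = qFact Q n * (1 - Q ^ (n + 1)) :=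
  prod_range_succ _ _

theorem qChoose_zero_right (Q : R) (n : ℕ) : qChoose Q n 0 = 1 := by
  cases n <;> rfl

theorem qChoose_succ_succ (Q : R) (n s : ℕ) :
    qChoose Q (n + 1) (s + 1) = qChoose Q n (s + 1) + Q ^ (n - s) * qChoose Q n s := rfl

theorem qChoose_eq_zero (Q : R) {n s : ℕ} (h : n < s) : qChoose Q n s = 0 := by
  induction n generalizing s with
  | zero => obtain ⟨s, rfl⟩ := Nat.exists_eq_succ_of_ne_zero h.ne'; rfl
  | succ n ih =>
    obtain ⟨s, rfl⟩ := Nat.exists_eq_succ_of_ne_zero (Nat.ne_zero_of_lt h)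
    rw [Nat.succ_eq_add_one, qChoose_succ_succ, ih (by omega), ih (by omega)]
    simp

theorem qChoose_mul_qFact (Q : R) (s t : ℕ) :
    qChoose Q (s + t) s * (qFact Q s * qFact Q t) = qFact Q (s + t) := by
  induction s generalizing t with
  | zero => simp [qChoose_zero_right, qFact]
  | succ s ihs =>
    induction t with
    | zero =>
      have h := ihs 0
      simp only [add_zero] at h ⊢
      rw [qChoose_succ_succ, qChoose_eq_zero Q (Nat.lt_succ_self s), qFact_succ, Nat.sub_self]
      linear_combination (1 - Q ^ (s + 1)) * h
    | succ t iht =>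
      have h := ihs (t + 1)
      rw [show s + 1 + (t + 1) = (s + t + 1) + 1 by ring, qChoose_succ_succ,
        qFact_succ Q (s + t + 1), show s + t + 1 - s = t + 1 by omega]
      rw [show s + 1 + t = s + t + 1 by ring] at iht
      rw [show s + (t + 1) = s + t + 1 by ring] at h
      rw [qFact_succ Q t] at h ⊢
      rw [qFact_succ Q s] at iht ⊢
      have e : Q ^ (s + t + 1 + 1) = Q ^ (t + 1) * Q ^ (s + 1) := by ring
      linear_combination (1 - Q ^ (t + 1)) * iht + Q ^ (t + 1) * (1 - Q ^ (s + 1)) * h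
        - qFact Q (s + t + 1) * e

/-- The q-binomial theorem. The extra variable `A` will be `Q ^ n`, which replaces the substitution
of z / Q^n for z when `Q` is not invertible. -/
theorem prod_sub_mul_pow (Q A z : R) (L : ℕ) :
    ∏ i ∈ range L, (A - z * Q ^ i) =
      ∑ s ∈ range (L + 1), (-1) ^ s * qChoose Q L s * A ^ (L - s) * z ^ s * Q ^ (s.choose 2) := by
  induction L with
  | zero => simp [qChoose]
  | succ L ih =>
    have h1 : ∑ s ∈ range (L + 1),
        (-1) ^ s * qChoose Q L s * A ^ (L + 1 - s) * z ^ s * Q ^ (s.choose 2) =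
        A * ∏ i ∈ range L, (A - z * Q ^ i) := by
      rw [ih, mul_sum]
      refine sum_congr rfl fun s hs => ?_
      rw [show L + 1 - s = (L - s) + 1 by have := mem_range.1 hs; omega]
      ring
    have h2 : ∑ s ∈ range (L + 1), (-1) ^ (s + 1) * (Q ^ (L - s) * qChoose Q L s) *
        A ^ (L + 1 - (s + 1)) * z ^ (s + 1) * Q ^ ((s + 1).choose 2) =
        - (z * Q ^ L) * ∏ i ∈ range L, (A - z * Q ^ i) := by
      rw [ih, mul_sum]
      refine sum_congr rfl fun s hs => ?_
      have hL : Q ^ L = Q ^ (L - s) * Q ^ s := by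
        rw [← pow_add, Nat.sub_add_cancel (by have := mem_range.1 hs; omega)]
      rw [Nat.add_sub_add_right, hL, show (s + 1).choose 2 = s + s.choose 2 by
        rw [Nat.choose_succ_succ' s 1, Nat.choose_one_right]]
      ring
    rw [sum_range_succ', prod_range_succ]
    simp only [qChoose_succ_succ, mul_add, add_mul, sum_add_distrib]
    rw [h2]
    rw [sum_range_succ'] at h1
    simp only [qChoose_zero_right] at h1 ⊢
    rw [sum_range_succ, qChoose_eq_zero Q (Nat.lt_succ_self L)]
    linear_combination -h1

/-- A finite form of the Jacobi triple product, with denominators cleared. -/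
theorem finite_triple_product (Q z w : R) (hzw : z * w = Q) (n m : ℕ) :
    Q ^ (n * m + n.choose 2) * z ^ n *
      ((∏ i ∈ range n, (1 - w * Q ^ i)) * ∏ i ∈ range m, (1 - z * Q ^ i)) =
    ∑ s ∈ range (n + m + 1), (-1) ^ (s + n) * qChoose Q (n + m) s *
      (z ^ s * Q ^ (s.choose 2 + n * (n + m - s))) := by
  -- The factors with i ≥ n are multiples of Q^n; for i < n, zw = Q gives Q^n - zQ^i = -zQ^i (1 -
  -- wQ^(n-1-i)).
  have h := prod_sub_mul_pow Q (Q ^ n) z (n + m)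
  have h1 : ∏ i ∈ range m, (Q ^ n - z * Q ^ (n + i)) =
      Q ^ (n * m) * ∏ i ∈ range m, (1 - z * Q ^ i) := by
    rw [pow_mul, ← card_range m, ← prod_const, card_range, ← prod_mul_distrib]
    exact prod_congr rfl fun i _ => by ring
  have h2 : ∏ i ∈ range n, (Q ^ n - z * Q ^ i) =
      Q ^ (n.choose 2) * ((-1) ^ n * z ^ n) * ∏ i ∈ range n, (1 - w * Q ^ i) := by
    have e : ∀ i ∈ range n, Q ^ n - z * Q ^ i = Q ^ i * (Q ^ (n - 1 - i + 1) - z) := by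
      intro i hi
      have := mem_range.1 hi
      rw [mul_sub, ← pow_add, show i + (n - 1 - i + 1) = n by omega, mul_comm z]
    rw [prod_congr rfl e, prod_mul_distrib, prod_range_reflect (fun i => Q ^ (i + 1) - z) n,
      prod_pow_eq_pow_sum, sum_range_id, ← Nat.choose_two_right, ← mul_pow, mul_assoc]
    congr 1
    conv_rhs => rw [← card_range n]
    rw [← prod_const, card_range, ← prod_mul_distrib]
    refine prod_congr rfl fun i _ => ?_
    rw [pow_succ]
    linear_combination (-Q ^ i) * hzw
  rw [prod_range_add, h1, h2] at h
  have h3 : ((-1 : R) ^ n) * (-1) ^ n = 1 := by rw [← mul_pow]; simp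
  calc _ = (-1) ^ n * (Q ^ n.choose 2 * ((-1) ^ n * z ^ n) * ∏ i ∈ range n, (1 - w * Q ^ i)) *
        (Q ^ (n * m) * ∏ i ∈ range m, (1 - z * Q ^ i)) := by
          rw [pow_add]
          linear_combination (-(Q ^ (n * m) * Q ^ n.choose 2 * z ^ n *
            ((∏ i ∈ range n, (1 - w * Q ^ i)) * ∏ i ∈ range m, (1 - z * Q ^ i)))) * h3
    _ = _ := by
      rw [mul_assoc, h, mul_sum]
      refine sum_congr rfl fun s _ => ?_
      rw [← pow_mul, pow_add, pow_add]
      ring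

end QBinomial

/-! ### The triple product modulo powers of q. -/

open PowerSeries (X)

theorem choose_add_two (s n : ℕ) : (s + n).choose 2 = s.choose 2 + n.choose 2 + s * n := by
  induction n with
  | zero => simp
  | succ n ih =>
    rw [← add_assoc, Nat.choose_succ_succ' (s + n) 1, Nat.choose_succ_succ' n 1, ih,
      Nat.choose_one_right, Nat.choose_one_right]
    ring

theorem choose_succ_two (n : ℕ) : (n + 1).choose 2 = n.choose 2 + n := by
  rw [choose_add_two]; simp

theorem sq_eq_choose (n : ℕ) : n ^ 2 = 2 * n.choose 2 + n := by
  induction n with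
  | zero => simp
  | succ n ih => rw [choose_succ_two, add_sq, ih]; ring

theorem neg_one_pow_sub_add {R : Type*} [CommRing R] {N n : ℕ} (h : n ≤ N) :
    (-1 : R) ^ (N - n + N) = (-1) ^ n := by
  obtain ⟨s, rfl⟩ := Nat.exists_eq_add_of_le h
  rw [show n + s - n + (n + s) = n + 2 * s by omega, pow_add, pow_mul]
  simp

/-- With N and N+1 factors the sum has 2N+2 terms, and the terms s = N-n and s = N+1+n are paired.
-/
theorem finite_triple_product_X (a b N : ℕ) :
    (∏ i ∈ range N, (1 - X ^ b * (X ^ (a + b)) ^ i)) *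
      (∏ i ∈ range (N + 1), (1 - X ^ a * (X ^ (a + b)) ^ i)) =
    ∑ n ∈ range (N + 1), (-1 : ℂ⟦X⟧) ^ n * X ^ (a * n.choose 2 + b * (n + 1).choose 2) *
      (qChoose (X ^ (a + b)) (2 * N + 1) (N - n) -
        qChoose (X ^ (a + b)) (2 * N + 1) (N + 1 + n) * X ^ ((2 * n + 1) * a)) := by
  have h := finite_triple_product ((X : ℂ⟦X⟧) ^ (a + b)) (X ^ a) (X ^ b) (pow_add X a b).symm
    N (N + 1)
  rw [show N + (N + 1) + 1 = (N + 1) + (N + 1) by ring, sum_range_add,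
    ← sum_range_reflect _ (N + 1), ← sum_add_distrib] at h
  have h0 : ((X : ℂ⟦X⟧) ^ (a + b)) ^ (N * (N + 1) + N.choose 2) * (X ^ a) ^ N ≠ 0 := by
    simp [PowerSeries.X_ne_zero]
  refine mul_left_cancel₀ h0 (h.trans ?_)
  rw [mul_sum]
  refine sum_congr rfl fun n hn => ?_
  have hn : n ≤ N := by have := mem_range.1 hn; omega
  rw [show N + 1 - 1 - n = N - n by omega, neg_one_pow_sub_add hn,
    show N + (N + 1) = 2 * N + 1 by ring,
    show N + 1 + n + N = 2 * N + (n + 1) by ring, pow_add (-1 : ℂ⟦X⟧) (2 * N), pow_mul (-1 : ℂ⟦X⟧) 2]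
  have e1 : ((X : ℂ⟦X⟧) ^ a) ^ (N - n) *
      (X ^ (a + b)) ^ ((N - n).choose 2 + N * (2 * N + 1 - (N - n))) =
      (X ^ (a + b)) ^ (N * (N + 1) + N.choose 2) * (X ^ a) ^ N *
        X ^ (a * n.choose 2 + b * (n + 1).choose 2) := by
    simp only [← pow_mul, ← pow_add]
    congr 1
    obtain ⟨s, rfl⟩ := Nat.exists_eq_add_of_le hn
    have : 2 * (n + s) + 1 - (n + s - n) = 2 * n + s + 1 := by omega
    rw [this, Nat.add_sub_cancel_left, choose_succ_two, choose_add_two]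
    have := sq_eq_choose n
    zify at this ⊢
    linear_combination ((a : ℤ) + b) * this
  have e2 : ((X : ℂ⟦X⟧) ^ a) ^ (N + 1 + n) *
      (X ^ (a + b)) ^ ((N + 1 + n).choose 2 + N * (2 * N + 1 - (N + 1 + n))) =
      (X ^ (a + b)) ^ (N * (N + 1) + N.choose 2) * (X ^ a) ^ N *
        (X ^ (a * n.choose 2 + b * (n + 1).choose 2) * X ^ ((2 * n + 1) * a)) := by
    simp only [← pow_mul, ← pow_add]
    congr 1
    obtain ⟨s, rfl⟩ := Nat.exists_eq_add_of_le hn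
    have : 2 * (n + s) + 1 - (n + s + 1 + n) = s := by omega
    rw [this, add_assoc (n + s), choose_add_two (n + s), add_comm 1 n, choose_succ_two]
    ring
  rw [e1, e2]
  simp only [pow_succ]
  ring

theorem X_pow_dvd_qFact_sub {M : ℕ} (hM : 1 ≤ M) {c s : ℕ} (h : c ≤ s) :
    (X : ℂ⟦X⟧) ^ (c + 1) ∣ qFact (X ^ M) s - qFact (X ^ M) c := by
  induction s, h using Nat.le_induction with
  | base => simp
  | succ s hs ih =>
    rw [qFact_succ, mul_one_sub, sub_right_comm]
    refine dvd_sub ih (Dvd.dvd.mul_left ?_ _)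
    rw [← pow_mul]
    exact pow_dvd_pow _ (le_trans (by omega) (Nat.le_mul_of_pos_left _ hM))

theorem X_pow_dvd_qFact_sub' {M : ℕ} (hM : 1 ≤ M) {c s t : ℕ} (h : c ≤ s) (h' : c ≤ t) :
    (X : ℂ⟦X⟧) ^ (c + 1) ∣ qFact (X ^ M) s - qFact (X ^ M) t := by
  simpa using dvd_sub (X_pow_dvd_qFact_sub hM h) (X_pow_dvd_qFact_sub hM h')

theorem isUnit_qFact {M : ℕ} (hM : 1 ≤ M) (s : ℕ) : IsUnit (qFact ((X : ℂ⟦X⟧) ^ M) s) := by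
  rw [PowerSeries.isUnit_iff_constantCoeff]
  have : M ≠ 0 := by omega
  simp [qFact, this]

/-- All the q-factorials involved have index at least c, so they are units congruent to each other
modulo X^(c+1). -/
theorem X_pow_dvd_qFact_mul_qChoose {M : ℕ} (hM : 1 ≤ M) {c s t N : ℕ} (hs : c ≤ s) (ht : c ≤ t)
    (hN : c ≤ N) :
    (X : ℂ⟦X⟧) ^ (c + 1) ∣ qFact (X ^ M) N * qChoose (X ^ M) (s + t) s - 1 := by
  refine ((isUnit_qFact hM s).dvd_mul_left).1 ?_
  have h := qChoose_mul_qFact ((X : ℂ⟦X⟧) ^ M) s t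
  have e : qFact ((X : ℂ⟦X⟧) ^ M) s * (qFact (X ^ M) N * qChoose (X ^ M) (s + t) s - 1) =
      qChoose (X ^ M) (s + t) s * qFact (X ^ M) s * (qFact (X ^ M) N - qFact (X ^ M) t) +
      (qFact (X ^ M) (s + t) - qFact (X ^ M) s) := by
    linear_combination h
  rw [e]
  exact dvd_add ((X_pow_dvd_qFact_sub' hM hN ht).mul_left _)
    (X_pow_dvd_qFact_sub' hM (by omega) hs)

theorem le_mul_choose_two {b : ℕ} (hb : 1 ≤ b) (n : ℕ) : n ≤ b * (n + 1).choose 2 := by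
  rw [choose_succ_two]
  exact le_trans (Nat.le_add_left _ _) (Nat.le_mul_of_pos_left _ hb)

theorem triple_product_congr (a : ℕ) {b : ℕ} (hb : 1 ≤ b) (N : ℕ) :
    (X : ℂ⟦X⟧) ^ (N + 1) ∣
      qFact (X ^ (a + b)) N * ((∏ i ∈ range N, (1 - X ^ b * (X ^ (a + b)) ^ i)) *
        (∏ i ∈ range (N + 1), (1 - X ^ a * (X ^ (a + b)) ^ i))) -
      ∑ n ∈ range (N + 1), (-1 : ℂ⟦X⟧) ^ n * X ^ (a * n.choose 2 + b * (n + 1).choose 2) *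
        (1 - X ^ ((2 * n + 1) * a)) := by
  rw [finite_triple_product_X, mul_sum, ← sum_sub_distrib]
  refine dvd_sum fun n hn => ?_
  have hn : n ≤ N := by have := mem_range.1 hn; omega
  have hM : 1 ≤ a + b := by omega
  -- The binomials are controlled only modulo X^(N-n+1); the prefactor supplies the missing X^n,
  -- since b ≥ 1.
  have h1 := X_pow_dvd_qFact_mul_qChoose hM (c := N - n) (s := N - n) (t := N + 1 + n) (N := N)
    le_rfl (by omega) (by omega)
  have h2 := X_pow_dvd_qFact_mul_qChoose hM (c := N - n) (s := N + 1 + n) (t := N - n) (N := N)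
    (by omega) le_rfl (by omega)
  rw [show N - n + (N + 1 + n) = 2 * N + 1 by omega] at h1
  rw [show N + 1 + n + (N - n) = 2 * N + 1 by omega] at h2
  have h3 : (X : ℂ⟦X⟧) ^ n ∣ X ^ (a * n.choose 2 + b * (n + 1).choose 2) :=
    pow_dvd_pow _ ((le_mul_choose_two hb n).trans (Nat.le_add_left _ _))
  have h4 := mul_dvd_mul h3 ((dvd_sub h1 (h2.mul_right (X ^ ((2 * n + 1) * a)))).mul_left
    ((-1) ^ n))
  rw [← pow_add, show n + (N - n + 1) = N + 1 by omega] at h4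
  convert h4 using 1
  ring

/-! ### The alternating series and its recursion. -/

/-- The `n`-th term of the alternating series for `G_{(k-1)j+k+1-i} ∏ (1 - q ^ n)`. -/
noncomputable def gordonTerm (k j i n : ℕ) : ℂ⟦X⟧ :=
  (-1) ^ n * X ^ (k * n ^ 2 + (k - i) * n + (n + 1).choose 2 + j * k * n) *
    (1 - X ^ ((2 * n + 1 + j) * i)) * ∏ m ∈ range j, (1 - X ^ (n + 1 + m))

/-- Partial sums of the alternating series for `G_{(k-1)j+k+1-i} ∏ (1 - q ^ n)`. -/
noncomputable def gordonSum (k j i N : ℕ) : ℂ⟦X⟧ := ∑ n ∈ range N, gordonTerm k j i n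

theorem gordonSum_zero (k j N : ℕ) : gordonSum k j 0 N = 0 := by
  simp [gordonSum, gordonTerm]

theorem X_pow_dvd_gordonTerm (k j i n : ℕ) : (X : ℂ⟦X⟧) ^ n ∣ gordonTerm k j i n := by
  have := choose_succ_two n
  unfold gordonTerm
  exact (((pow_dvd_pow _ (by omega)).mul_left _).mul_right _).mul_right _

theorem X_pow_dvd_gordonSum_sub (k j i : ℕ) {T N : ℕ} (h : T ≤ N) :
    (X : ℂ⟦X⟧) ^ T ∣ gordonSum k j i N - gordonSum k j i T := by
  obtain ⟨d, rfl⟩ := Nat.exists_eq_add_of_le h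
  rw [gordonSum, sum_range_add, gordonSum, add_sub_cancel_left]
  exact dvd_sum fun n _ => (pow_dvd_pow _ (Nat.le_add_right _ _)).trans
    (X_pow_dvd_gordonTerm _ _ _ _)

/-- The right side is u_n - u_(n+1). It arises because the product of j+1 factors can be split at
its last factor or at its first. -/
theorem gordonTerm_telescope (k j i n : ℕ) (hik : i + 1 ≤ k) :
    gordonTerm k j (i + 1) n - gordonTerm k j i n -
        X ^ ((j + 1) * i) * gordonTerm k (j + 1) (k - i) n =
      (-1) ^ n * X ^ (k * n ^ 2 + (k - (i + 1)) * n + (n + 1).choose 2 + j * k * n) * (1 - X ^ n) *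
          ∏ m ∈ range j, (1 - X ^ (n + 1 + m)) -
      (-1) ^ (n + 1) * X ^ (k * (n + 1) ^ 2 + (k - (i + 1)) * (n + 1) + (n + 1 + 1).choose 2 +
            j * k * (n + 1)) * (1 - X ^ (n + 1)) *
          ∏ m ∈ range j, (1 - X ^ (n + 1 + 1 + m)) := by
  obtain ⟨d, rfl⟩ := Nat.exists_eq_add_of_le hik
  have e1 : ∏ m ∈ range (j + 1), (1 - (X : ℂ⟦X⟧) ^ (n + 1 + m)) =
      (∏ m ∈ range j, (1 - X ^ (n + 1 + m))) * (1 - X ^ (n + 1 + j)) := prod_range_succ _ _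
  have e2 : ∏ m ∈ range (j + 1), (1 - (X : ℂ⟦X⟧) ^ (n + 1 + m)) =
      (1 - X ^ (n + 1)) * (∏ m ∈ range j, (1 - X ^ (n + 1 + 1 + m))) := by
    rw [prod_range_succ', mul_comm]
    simp only [add_zero]
    congr 1
    exact prod_congr rfl fun m _ => by ring_nf
  rw [mul_assoc ((-1) ^ (n + 1) * _), ← e2]
  unfold gordonTerm
  rw [e1, show i + 1 + d - (i + 1) = d by omega, show i + 1 + d - i = d + 1 by omega,
    show i + 1 + d - (d + 1) = i by omega, choose_succ_two (n + 1)]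
  ring

theorem gordonSum_rec (k j i N : ℕ) (hik : i + 1 ≤ k) :
    (X : ℂ⟦X⟧) ^ N ∣ gordonSum k j (i + 1) N - gordonSum k j i N -
      X ^ ((j + 1) * i) * gordonSum k (j + 1) (k - i) N := by
  unfold gordonSum
  rw [mul_sum, ← sum_sub_distrib, ← sum_sub_distrib,
    sum_congr rfl fun n _ => gordonTerm_telescope k j i n hik]
  rw [sum_range_sub' (fun n => (-1 : ℂ⟦X⟧) ^ n *
    X ^ (k * n ^ 2 + (k - (i + 1)) * n + (n + 1).choose 2 + j * k * n) * (1 - X ^ n) *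
          ∏ m ∈ range j, (1 - X ^ (n + 1 + m)))]
  -- Here u_0 = 0 because of the factor 1 - X^0, and the exponent in u_N is at least C(N+1,2) ≥ N.
  have := choose_succ_two N
  simp only [pow_zero, sub_self, mul_zero, zero_mul, zero_sub, dvd_neg]
  exact (((pow_dvd_pow _ (by omega)).mul_left _).mul_right _).mul_right _

/-! ### Infinite products and residue classes modulo 2k+1. -/

theorem X_pow_dvd_tprod_sub {f : ℕ → ℂ⟦X⟧} (hf : Multipliable f) {T : ℕ} {c : ℂ⟦X⟧}
    (h : ∃ᶠ N in Filter.atTop, X ^ T ∣ ∏ n ∈ range N, f n - c) : X ^ T ∣ ∏' n, f n - c := by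
  rw [PowerSeries.X_pow_dvd_iff]
  intro d hd
  have ht := ((PowerSeries.WithPiTopology.continuous_coeff ℂ d).tendsto _).comp
    hf.hasProd.tendsto_prod_nat
  have hm : PowerSeries.coeff d (∏' n, f n) ∈ ({PowerSeries.coeff d c} : Set ℂ) := by
    refine isClosed_singleton.mem_of_frequently_of_tendsto (h.mono fun N hN => ?_) ht
    have := PowerSeries.X_pow_dvd_iff.1 hN d hd
    rw [map_sub, sub_eq_zero] at this
    exact this
  rw [map_sub, sub_eq_zero]
  exact hm

/-- The Euler product `∏ (1 - q ^ n)` over `n ≥ 1`. -/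
noncomputable def eulerProduct : ℂ⟦X⟧ := ∏' n : ℕ, (1 - X ^ (n + 1))

theorem X_pow_dvd_eulerProduct_sub (j : ℕ) :
    X ^ (j + 1) ∣ eulerProduct - ∏ m ∈ range j, (1 - X ^ (m + 1)) := by
  refine X_pow_dvd_tprod_sub (PowerSeries.WithPiTopology.multipliable_one_sub_X_pow ℂ)
    (Filter.Eventually.frequently ?_)
  filter_upwards [Filter.eventually_ge_atTop j] with N hN
  simpa [qFact] using X_pow_dvd_qFact_sub le_rfl hN

theorem allowed_iff {k i : ℕ} (h1 : 1 ≤ i) (hk : i ≤ k) (N : ℕ) {r : ℕ} (hr : r < 2 * k + 1) :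
    Allowed k i ((2 * k + 1) * N + r + 1) ↔
      ¬ (r = 2 * k ∨ r = 2 * k - (k + 1 - i) ∨ r = k - i) := by
  have key : ∀ u : ℤ, (((2 * k + 1) * N + r + 1 : ℕ) : ℤ) ≡ u [ZMOD (2 * k + 1)] ↔
      (2 * k + 1 : ℤ) ∣ r + 1 - u := by
    intro u
    rw [Int.modEq_comm, Int.modEq_iff_dvd]
    push_cast
    rw [show (2 * k + 1 : ℤ) * N + r + 1 - u = (r + 1 - u) + (2 * k + 1) * N by ring]
    exact Int.dvd_add_left (Dvd.intro _ rfl)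
  have small : ∀ v : ℤ, |v| < 2 * k + 1 → ((2 * k + 1 : ℤ) ∣ v ↔ v = 0) := fun v hv =>
    ⟨fun h => Int.eq_zero_of_abs_lt_dvd h hv, fun h => h ▸ dvd_zero _⟩
  -- Shifting by the modulus brings the absolute value below 2k+1, where divisibility means
  -- vanishing.
  have e1 : (2 * k + 1 : ℤ) ∣ r + 1 - 0 ↔ (2 * k + 1 : ℤ) ∣ r - 2 * k := by
    rw [← dvd_sub_self_right]
    ring_nf
  have e2 : (2 * k + 1 : ℤ) ∣ r + 1 - -(k + 1 - i) ↔
      (2 * k + 1 : ℤ) ∣ r + 1 + (k + 1 - i) - (2 * k + 1) := by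
    rw [dvd_sub_self_right, sub_neg_eq_add]
  rw [Allowed, key, key, key, e1, e2, small, small, small]
  · omega
  all_goals rw [abs_lt]; omega

theorem prod_block {k i : ℕ} (h1 : 1 ≤ i) (hk : i ≤ k) (N : ℕ) :
    ∏ r ∈ range (2 * k + 1), (if Allowed k i ((2 * k + 1) * N + r + 1) then (1 : ℂ⟦X⟧)
        else 1 - X ^ ((2 * k + 1) * N + r + 1)) =
      (1 - (X ^ (2 * k + 1)) ^ (N + 1)) * ((1 - X ^ (k + i) * (X ^ (2 * k + 1)) ^ N) *
        (1 - X ^ (k + 1 - i) * (X ^ (2 * k + 1)) ^ N)) := by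
  have hs : ({2 * k, 2 * k - (k + 1 - i), k - i} : Finset ℕ) ⊆ range (2 * k + 1) := by
    intro r
    simp only [mem_insert, mem_singleton, mem_range]
    omega
  rw [← prod_subset hs]
  · rw [prod_insert, prod_insert, prod_singleton, if_neg, if_neg, if_neg]
    · simp only [← pow_mul, ← pow_add]
      rw [show (2 * k + 1) * N + 2 * k + 1 = (2 * k + 1) * (N + 1) by ring,
        show (2 * k + 1) * N + (2 * k - (k + 1 - i)) + 1 = k + i + (2 * k + 1) * N by omega,
        show (2 * k + 1) * N + (k - i) + 1 = k + 1 - i + (2 * k + 1) * N by omega]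
    · rw [allowed_iff h1 hk N (by omega)]; simp
    · rw [allowed_iff h1 hk N (by omega)]; simp
    · rw [allowed_iff h1 hk N (by omega)]; simp
    · simp only [mem_singleton]; omega
    · simp only [mem_insert, mem_singleton]; omega
  · intro r hr hn
    rw [if_pos]
    rw [allowed_iff h1 hk N (mem_range.1 hr)]
    simpa using hn

theorem prod_range_not_allowed {k i : ℕ} (h1 : 1 ≤ i) (hk : i ≤ k) (N : ℕ) :
    ∏ n ∈ range ((2 * k + 1) * N), (if Allowed k i (n + 1) then (1 : ℂ⟦X⟧)
        else 1 - X ^ (n + 1)) =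
      qFact (X ^ (2 * k + 1)) N * ((∏ m ∈ range N, (1 - X ^ (k + i) * (X ^ (2 * k + 1)) ^ m)) *
        ∏ m ∈ range N, (1 - X ^ (k + 1 - i) * (X ^ (2 * k + 1)) ^ m)) := by
  induction N with
  | zero => simp [qFact]
  | succ N ih =>
    rw [mul_add_one, prod_range_add, ih, prod_block h1 hk, qFact_succ, prod_range_succ _ N,
      prod_range_succ _ N]
    ring

theorem product_mul_eulerProduct (k i : ℕ) :
    product k i * eulerProduct = ∏' n : ℕ, (if Allowed k i (n + 1) then (1 : ℂ⟦X⟧)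
        else 1 - X ^ (n + 1)) ∧
    Multipliable fun n : ℕ => (if Allowed k i (n + 1) then (1 : ℂ⟦X⟧)
        else 1 - X ^ (n + 1)) := by
  have e : (fun n : ℕ => factor k i (n + 1) * (1 - X ^ (n + 1))) =
      fun n : ℕ => (if Allowed k i (n + 1) then (1 : ℂ⟦X⟧) else 1 - X ^ (n + 1)) := by
    funext n
    unfold factor
    split_ifs
    · exact PowerSeries.inv_mul_cancel _ (by simp)
    · exact one_mul _
  have h1 := multipliable_factor k i
  have h2 := PowerSeries.WithPiTopology.multipliable_one_sub_X_pow ℂ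
  refine ⟨?_, e ▸ h1.mul h2⟩
  rw [product, eulerProduct, ← h1.tprod_mul h2, e]

/-- The Jacobi triple product, in the form of congruences modulo all powers of `q`. -/
theorem X_pow_dvd_product_mul_eulerProduct_sub {k i : ℕ} (h1 : 1 ≤ i) (hk : i ≤ k) (T : ℕ) :
    X ^ T ∣ product k i * eulerProduct - gordonSum k 0 (k + 1 - i) T := by
  obtain ⟨e, hm⟩ := product_mul_eulerProduct k i
  rw [e]
  refine X_pow_dvd_tprod_sub hm (Filter.frequently_atTop.2 fun N₀ => ?_)
  -- Only partial products made of complete blocks of residues are compared, hence the use of a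
  -- frequent condition.
  refine ⟨(2 * k + 1) * (N₀ + T), ?_, ?_⟩
  · exact le_trans (Nat.le_add_right _ _) (Nat.le_mul_of_pos_left _ (by omega))
  generalize hN : N₀ + T = N
  have hTN : T ≤ N := by omega
  rw [prod_range_not_allowed h1 hk]
  have h2 := triple_product_congr (k + 1 - i) (b := k + i) (by omega) N
  rw [show k + 1 - i + (k + i) = 2 * k + 1 by omega] at h2
  have h3 : ∑ n ∈ range (N + 1), (-1 : ℂ⟦X⟧) ^ n *
      X ^ ((k + 1 - i) * n.choose 2 + (k + i) * (n + 1).choose 2) *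
        (1 - X ^ ((2 * n + 1) * (k + 1 - i))) = gordonSum k 0 (k + 1 - i) (N + 1) := by
    refine sum_congr rfl fun n _ => ?_
    rw [gordonTerm, range_zero, prod_empty, mul_one, add_zero, zero_mul, zero_mul, add_zero]
    congr 3
    rw [choose_succ_two, sq_eq_choose]
    obtain ⟨d, rfl⟩ := Nat.exists_eq_add_of_le hk
    rw [show i + d + 1 - i = d + 1 by omega, show i + d - (d + 1) = i - 1 by omega]
    obtain ⟨i, rfl⟩ := Nat.exists_eq_add_of_le' h1
    rw [Nat.add_sub_cancel]
    ring
  rw [h3, prod_range_succ _ N] at h2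
  have h4 := X_pow_dvd_gordonSum_sub k 0 (k + 1 - i) (show T ≤ N + 1 by omega)
  -- The finite triple product has one factor more than the blocks do; it is 1 modulo X^T.
  have h5 : (X : ℂ⟦X⟧) ^ T ∣ (X ^ (2 * k + 1)) ^ N := by
    rw [← pow_mul]
    exact pow_dvd_pow _ (hTN.trans (Nat.le_mul_of_pos_left _ (by omega)))
  have h6 := dvd_add (dvd_add ((pow_dvd_pow X (show T ≤ N + 1 by omega)).trans h2) h4)
    (h5.mul_left (qFact (X ^ (2 * k + 1)) N *
      ((∏ m ∈ range N, (1 - X ^ (k + i) * (X ^ (2 * k + 1)) ^ m)) *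
        ∏ m ∈ range N, (1 - X ^ (k + 1 - i) * (X ^ (2 * k + 1)) ^ m)) * X ^ (k + 1 - i)))
  convert h6 using 1
  ring

/-! ### Leading terms and uniqueness for the recursion. -/

theorem X_pow_dvd_gordonSum_sub_eulerProduct {k j i N : ℕ} (hi : 1 ≤ i) (hk : i ≤ k)
    (hN : 1 ≤ N) : X ^ (j + 1) ∣ gordonSum k j i N - eulerProduct := by
  obtain ⟨N, rfl⟩ := Nat.exists_eq_add_of_le' hN
  have h0 := X_pow_dvd_eulerProduct_sub j
  have h1 : X ^ (j + 1) ∣ gordonTerm k j i 0 - ∏ m ∈ range j, (1 - X ^ (m + 1)) := by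
    rw [gordonTerm]
    have e : (2 * 0 + 1 + j) * i = (j + 1) + (j + 1) * (i - 1) := by
      obtain ⟨i, rfl⟩ := Nat.exists_eq_add_of_le' hi
      rw [Nat.add_sub_cancel]
      ring
    rw [e, pow_add]
    refine ⟨-X ^ ((j + 1) * (i - 1)) * ∏ m ∈ range j, (1 - X ^ (m + 1)), ?_⟩
    have e' : ∏ m ∈ range j, (1 - (X : ℂ⟦X⟧) ^ (0 + 1 + m)) = ∏ m ∈ range j, (1 - X ^ (m + 1)) :=
      prod_congr rfl fun m _ => by ring_nf
    rw [e']
    simp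
    ring
  have h2 : X ^ (j + 1) ∣ ∑ n ∈ range N, gordonTerm k j i (n + 1) := by
    refine dvd_sum fun n _ => ?_
    unfold gordonTerm
    refine (((pow_dvd_pow _ ?_).mul_left _).mul_right _).mul_right _
    have := choose_succ_two (n + 1)
    have : j ≤ j * k * (n + 1) := by
      rw [mul_assoc]
      exact Nat.le_mul_of_pos_right _ (Nat.mul_pos (by omega) (by omega))
    omega
  rw [gordonSum, sum_range_succ']
  convert dvd_sub (dvd_add h1 h2) h0 using 1
  ring

/-- Level j is determined by level j+1 and by i = 0, so the induction descends from level N, with an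
inner induction on i. -/
theorem X_pow_dvd_of_rec {k N : ℕ} {D : ℕ → ℕ → ℂ⟦X⟧} (h0 : ∀ j, X ^ N ∣ D j 0)
    (hrec : ∀ j i, i + 1 ≤ k →
      X ^ N ∣ D j (i + 1) - D j i - X ^ ((j + 1) * i) * D (j + 1) (k - i))
    (hlead : ∀ i, 1 ≤ i → i ≤ k → X ^ N ∣ D N i) {i : ℕ} (hi : i ≤ k) : X ^ N ∣ D 0 i := by
  suffices h : ∀ d ≤ N, ∀ i ≤ k, X ^ N ∣ D (N - d) i by
    simpa using h N le_rfl i hi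
  intro d
  induction d with
  | zero =>
    intro _ i hi
    rcases Nat.eq_zero_or_pos i with rfl | h
    · exact h0 _
    · exact hlead i h hi
  | succ d ih =>
    intro hd i
    induction i with
    | zero => exact fun _ => h0 _
    | succ i ihi =>
      intro hi
      have h1 := ih (by omega) (k - i) (Nat.sub_le _ _)
      have h2 := hrec (N - (d + 1)) i hi
      rw [show N - (d + 1) + 1 = N - d by omega] at h2
      convert dvd_add (dvd_add h2 (ihi (by omega))) (h1.mul_left (X ^ ((N - d) * i))) using 1
      ring

/-- Solutions of the recursion whose leading terms are `1` are given by the products. -/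
theorem product_eq_of_rec {k : ℕ} {F : ℕ → ℕ → ℂ⟦X⟧} (h0 : ∀ j, F j 0 = 0)
    (hrec : ∀ j i, i + 1 ≤ k → F j (i + 1) = F j i + X ^ ((j + 1) * i) * F (j + 1) (k - i))
    (hlead : ∀ j i, 1 ≤ i → i ≤ k → X ^ (j + 1) ∣ F j i - 1) {l : ℕ} (h1 : 1 ≤ l) (hl : l ≤ k) :
    product k l = F 0 (k + 1 - l) := by
  have hne : eulerProduct ≠ 0 := PowerSeries.WithPiTopology.tprod_one_sub_X_pow_ne_zero ℂ
  refine mul_right_cancel₀ hne ?_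
  rw [← sub_eq_zero]
  ext d
  have key : X ^ (d + 1) ∣ gordonSum k 0 (k + 1 - l) (d + 1) -
      F 0 (k + 1 - l) * eulerProduct := by
    refine X_pow_dvd_of_rec (k := k) (N := d + 1)
      (D := fun j i => gordonSum k j i (d + 1) - F j i * eulerProduct) ?_ ?_ ?_ (by omega)
    · intro j
      simp [gordonSum_zero, h0]
    · intro j i hi
      convert gordonSum_rec k j i (d + 1) hi using 1
      simp only [hrec j i hi]
      ring
    · intro i hi hik
      convert (pow_dvd_pow X (Nat.le_succ (d + 1))).trans (dvd_sub
        (X_pow_dvd_gordonSum_sub_eulerProduct (j := d + 1) (N := d + 1) hi hik (by omega))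
        ((hlead (d + 1) i hi hik).mul_right eulerProduct)) using 1
      ring
  have h := dvd_add (X_pow_dvd_product_mul_eulerProduct_sub h1 hl (d + 1)) key
  rw [sub_add_sub_cancel] at h
  exact PowerSeries.X_pow_dvd_iff.1 h d (Nat.lt_succ_self d)

end Gordon

/-! ### The recursion for partitions. -/

namespace Gordon

open PowerSeries (X)

/-- In a nonincreasing list the entries that are at least `x` form an initial segment. -/
theorem le_getElem_iff_lt_countP {L : List ℕ} (hL : L.Pairwise (· ≥ ·)) (x : ℕ) {s : ℕ}
    (hs : s < L.length) : x ≤ L[s] ↔ s < L.countP (x ≤ ·) := by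
  induction L generalizing s with
  | nil => simp at hs
  | cons b L ih =>
    obtain ⟨hb, hL⟩ := List.pairwise_cons.1 hL
    rw [List.countP_cons]
    by_cases hx : x ≤ b
    · cases s with
      | zero => simp [hx]
      | succ s =>
        simp only [List.length_cons] at hs
        simp [hx, ih hL (show s < L.length by omega)]
    · have h0 : L.countP (x ≤ ·) = 0 := by
        rw [List.countP_eq_zero]
        intro c hc
        have := hb c hc
        simp
        omega
      have h1 : ¬ x ≤ (b :: L)[s] := by
        rcases List.mem_cons.1 (List.getElem_mem hs) with h | h
        · rwa [h]
        · have := hb _ h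
          omega
      simp [h0, hx, h1]

theorem countP_le_eq (L : List ℕ) (a : ℕ) :
    L.countP (a ≤ ·) = L.countP (a + 2 ≤ ·) + (L.count a + L.count (a + 1)) := by
  induction L with
  | nil => rfl
  | cons b L ih =>
    simp only [List.countP_cons, List.count_cons, ih]
    rcases lt_trichotomy b a with h | rfl | h
    · simp [show ¬ a ≤ b by omega, show ¬ a + 2 ≤ b by omega, show b ≠ a by omega,
        show b ≠ a + 1 by omega]
    · simp; omega
    · rcases (show b = a + 1 ∨ a + 2 ≤ b by omega) with rfl | h'
      · simp; omega
      · simp [h.le, h', show b ≠ a by omega, show b ≠ a + 1 by omega]; omega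

theorem forall_getElem_add_two_le_iff {L : List ℕ} (hL : L.Pairwise (· ≥ ·)) (t : ℕ) :
    (∀ (s : ℕ) (h : s + t < L.length), L[s + t] + 2 ≤ L[s]) ↔
      ∀ a, L.count a + L.count (a + 1) ≤ t := by
  constructor
  · intro h a
    by_contra! hlt
    have e := countP_le_eq L a
    have hlen := List.countP_le_length (p := (a ≤ ·)) (l := L)
    -- This position holds the first entry below a+2; with more than t entries in {a, a+1}, the
    -- entry t places later is still at least a.
    have hs : L.countP (a + 2 ≤ ·) + t < L.length := by omega
    have h1 := (le_getElem_iff_lt_countP hL a hs).2 (by omega)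
    have h2 := h _ hs
    exact absurd ((le_getElem_iff_lt_countP hL (a + 2) (by omega)).1 (by omega)) (lt_irrefl _)
  · intro h s hs
    have h1 := (le_getElem_iff_lt_countP hL _ hs).1 le_rfl
    rw [le_getElem_iff_lt_countP hL]
    have e := countP_le_eq L L[s + t]
    have := h L[s + t]
    omega

theorem diffTwoAtDistance_iff {t m : ℕ} (p : m.Partition) :
    DiffTwoAtDistance t p ↔ ∀ a, p.parts.count a + p.parts.count (a + 1) ≤ t := by
  rw [DiffTwoAtDistance, forall_getElem_add_two_le_iff
    (show (sortedParts p).Pairwise (· ≥ ·) from Multiset.pairwise_sort _ _)]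
  simp only [← Multiset.coe_count, sortedParts, Multiset.sort_eq]

/-- The multisets of parts, all greater than `j`, with sum `m`, with difference at least `2` at
distance `k - 1`, and in which `j + 1` appears less than `i` times. -/
def partsSet (k j i m : ℕ) : Set (Multiset ℕ) :=
  {s | s.sum = m ∧ (∀ a ∈ s, j < a) ∧ (∀ a, s.count a + s.count (a + 1) ≤ k - 1) ∧
    s.count (j + 1) < i}

theorem partsSet_eq_image {k l : ℕ} (hlk : l ≤ k) (j m : ℕ) :
    partsSet k j (k + 1 - l) m = Nat.Partition.parts '' {p : m.Partition |
      DiffTwoAtDistance (k - 1) p ∧ (∀ a ∈ p.parts, j < a) ∧ p.parts.count (j + 1) ≤ k - l} := by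
  ext s
  simp only [partsSet, Set.mem_ofPred_eq, Set.mem_image, diffTwoAtDistance_iff]
  constructor
  · rintro ⟨h1, h2, h3, h4⟩
    exact ⟨⟨s, fun h => Nat.zero_lt_of_lt (h2 _ h), h1⟩, ⟨h3, h2, by simp; omega⟩, rfl⟩
  · rintro ⟨p, ⟨h3, h2, h4⟩, rfl⟩
    exact ⟨p.parts_sum, h2, h3, by omega⟩

theorem numPartitions_eq_ncard {k l : ℕ} (hlk : l ≤ k) (j m : ℕ) :
    numPartitions k j l m = (partsSet k j (k + 1 - l) m).ncard := by
  rw [partsSet_eq_image hlk, Set.ncard_image_of_injective _ fun p q h => Nat.Partition.ext h]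
  rfl

theorem finite_partsSet (k j i m : ℕ) : (partsSet k j i m).Finite := by
  refine (Set.finite_range (Nat.Partition.parts (n := m))).subset ?_
  rintro s ⟨h1, h2, -⟩
  exact ⟨⟨s, fun h => Nat.zero_lt_of_lt (h2 _ h), h1⟩, rfl⟩

theorem partsSet_zero (k j m : ℕ) : partsSet k j 0 m = ∅ := by
  ext s
  simp [partsSet]

theorem mem_partsSet_add_replicate {k i j m : ℕ} (hik : i + 1 ≤ k) (s : Multiset ℕ) :
    (s + Multiset.replicate i (j + 1) ∈ partsSet k j (i + 1) (m + (j + 1) * i) ∧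
      (s + Multiset.replicate i (j + 1)).count (j + 1) = i) ↔
      s ∈ partsSet k (j + 1) (k - i) m := by
  simp only [partsSet, Set.mem_ofPred_eq, Multiset.sum_add, Multiset.sum_replicate, smul_eq_mul,
    Multiset.count_add, Multiset.count_replicate, Multiset.mem_add, Multiset.mem_replicate,
    mul_comm i, add_left_inj, if_true]
  constructor
  · rintro ⟨⟨h1, h2, h3, -⟩, h0⟩
    have h0 : s.count (j + 1) = 0 := by omega
    refine ⟨h1, fun a ha => ?_, fun a => le_trans (by omega) (h3 a), ?_⟩
    · have := h2 a (Or.inl ha)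
      have : a ≠ j + 1 := by
        rintro rfl
        exact Multiset.count_eq_zero.1 h0 ha
      omega
    -- The i copies of j+1 leave room for at most k-1-i copies of j+2: this is where the index k-i
    -- comes from.
    · have := h3 (j + 1)
      simp at this
      omega
  · rintro ⟨h1, h2, h3, h4⟩
    have h0 : s.count (j + 1) = 0 := Multiset.count_eq_zero.2 fun h => lt_irrefl _ (h2 _ h)
    have h0' : s.count j = 0 := Multiset.count_eq_zero.2 fun h => by have := h2 _ h; omega
    refine ⟨⟨h1, ?_, fun a => ?_, by omega⟩, by omega⟩
    · rintro a (ha | ⟨-, rfl⟩)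
      · have := h2 _ ha; omega
      · omega
    · rcases eq_or_ne a j with rfl | h
      · simp; omega
      · rcases eq_or_ne a (j + 1) with rfl | h'
        · simp; omega
        · have := h3 a
          simp [h.symm, h'.symm]
          omega

theorem partsSet_succ {k i : ℕ} (hik : i + 1 ≤ k) (j m : ℕ) :
    (partsSet k j (i + 1) m).ncard = (partsSet k j i m).ncard +
      if (j + 1) * i ≤ m then (partsSet k (j + 1) (k - i) (m - (j + 1) * i)).ncard else 0 := by
  have e : partsSet k j (i + 1) m =
      partsSet k j i m ∪ {s ∈ partsSet k j (i + 1) m | s.count (j + 1) = i} := by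
    ext s
    simp only [partsSet, Set.mem_union, Set.mem_ofPred_eq]
    constructor
    · rintro ⟨h1, h2, h3, h4⟩
      rcases (Nat.lt_succ_iff.1 h4).lt_or_eq with h | h
      · exact Or.inl ⟨h1, h2, h3, h⟩
      · exact Or.inr ⟨⟨h1, h2, h3, h4⟩, h⟩
    · rintro (⟨h1, h2, h3, h4⟩ | h)
      · exact ⟨h1, h2, h3, by omega⟩
      · exact h.1
  have hd : Disjoint (partsSet k j i m) {s ∈ partsSet k j (i + 1) m | s.count (j + 1) = i} := by
    rw [Set.disjoint_left]
    rintro s ⟨-, -, -, h⟩ ⟨-, h'⟩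
    omega
  rw [e, Set.ncard_union_eq hd (finite_partsSet _ _ _ _)
    ((finite_partsSet _ _ _ _).subset (Set.sep_subset _ _))]
  congr 1
  have hrep : ∀ s : Multiset ℕ, s.count (j + 1) = i →
      s - Multiset.replicate i (j + 1) + Multiset.replicate i (j + 1) = s := fun s hs =>
    Multiset.sub_add_cancel (Multiset.le_count_iff_replicate_le.1 hs.ge)
  split_ifs with hm
  · obtain ⟨m, rfl⟩ := Nat.exists_eq_add_of_le' hm
    rw [Nat.add_sub_cancel, ← Set.ncard_image_of_injective (partsSet k (j + 1) (k - i) m)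
      (add_left_injective (Multiset.replicate i (j + 1)))]
    congr 1
    ext s
    constructor
    · intro hs
      refine ⟨s - Multiset.replicate i (j + 1), ?_, hrep s hs.2⟩
      rw [← mem_partsSet_add_replicate hik, hrep s hs.2]
      exact hs
    · rintro ⟨s, hs, rfl⟩
      exact (mem_partsSet_add_replicate hik s).2 hs
  · rw [Set.ncard_eq_zero ((finite_partsSet _ _ _ _).subset (Set.sep_subset _ _)),
      Set.eq_empty_iff_forall_notMem]
    rintro s ⟨⟨h1, -⟩, h⟩
    rw [← hrep s h, Multiset.sum_add, Multiset.sum_replicate, smul_eq_mul, mul_comm i] at h1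
    omega

/-- The generating function of the partitions counted by `partsSet`. -/
noncomputable def partsGenFun (k j i : ℕ) : ℂ⟦X⟧ :=
  PowerSeries.mk fun m => ((partsSet k j i m).ncard : ℂ)

theorem partsGenFun_zero (k j : ℕ) : partsGenFun k j 0 = 0 := by
  ext m
  simp [partsGenFun, partsSet_zero]

theorem partsGenFun_succ (k j i : ℕ) (hik : i + 1 ≤ k) :
    partsGenFun k j (i + 1) =
      partsGenFun k j i + X ^ ((j + 1) * i) * partsGenFun k (j + 1) (k - i) := by
  ext m
  rw [map_add, PowerSeries.coeff_X_pow_mul']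
  simp only [partsGenFun, PowerSeries.coeff_mk, partsSet_succ hik j m]
  push_cast
  rfl

/-- When all parts exceed j, only the empty partition has sum at most j. -/
theorem X_pow_dvd_partsGenFun_sub_one (k j i : ℕ) (hi : 1 ≤ i) :
    X ^ (j + 1) ∣ partsGenFun k j i - 1 := by
  rw [PowerSeries.X_pow_dvd_iff]
  intro m hm
  rw [map_sub, sub_eq_zero, PowerSeries.coeff_one, partsGenFun, PowerSeries.coeff_mk]
  have h0 : ∀ s ∈ partsSet k j i m, s = 0 := by
    rintro s ⟨h1, h2, -⟩
    refine Multiset.eq_zero_of_forall_notMem fun a ha => ?_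
    have := h2 a ha
    have := Multiset.le_sum_of_mem ha
    omega
  split_ifs with h
  · subst h
    have : partsSet k j i 0 = {0} := by
      refine Set.eq_singleton_iff_unique_mem.2 ⟨?_, h0⟩
      simp [partsSet]
      omega
    simp [this]
  · have : partsSet k j i m = ∅ := by
      refine Set.eq_empty_iff_forall_notMem.2 fun s hs => h ?_
      rw [← hs.1, h0 s hs, Multiset.sum_zero]
    simp [this]

/-! ### Gordon's identities and the conclusion. -/

/-- Gordon's identities. -/
theorem product_eq_partsGenFun {k l : ℕ} (h1 : 1 ≤ l) (hl : l ≤ k) :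
    product k l = partsGenFun k 0 (k + 1 - l) :=
  product_eq_of_rec (partsGenFun_zero k) (partsGenFun_succ k)
    (fun j i hi _ => X_pow_dvd_partsGenFun_sub_one k j i hi) h1 hl

theorem G_eq_partsGenFun {k : ℕ} (hk : 2 ≤ k) (j : ℕ) {l : ℕ} (h1 : 1 ≤ l) (hl : l ≤ k) :
    G k ((k - 1) * j + l) = (partsGenFun k j (k + 1 - l) : ℂ⸨X⸩) := by
  induction j generalizing l with
  | zero => rw [mul_zero, zero_add, G_of_le hl, product_eq_partsGenFun h1 hl]
  | succ j ih =>
    rcases h1.eq_or_lt with rfl | h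
    -- The case l = 1 is outside the recursion of `G`: the index is that of (j, k), and F(j,1) =
    -- F(j+1,k) is the partition recursion at i = 0.
    · have e : (k - 1) * (j + 1) + 1 = (k - 1) * j + k := by
        rw [mul_add_one]
        omega
      have h := partsGenFun_succ k j 0 (by omega)
      rw [partsGenFun_zero, mul_zero, pow_zero, one_mul, zero_add, zero_add, Nat.sub_zero] at h
      rw [e, ih (by omega) le_rfl, Nat.add_sub_cancel_left, Nat.add_sub_cancel, h]
    · have hX : ((X : ℂ⟦X⟧) : ℂ⸨X⸩) ^ ((l - 1) * (j + 1)) ≠ 0 := by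
        refine pow_ne_zero _ ?_
        simp
      have hs := partsGenFun_succ k j (l - 1) (by omega)
      rw [G_rec (by omega) h hl, div_eq_iff hX, Nat.add_sub_cancel, add_assoc, add_assoc,
        ih (by omega) (by omega), ih (by omega) (by omega),
        show k + 1 - (k - l + 1) = l - 1 + 1 by omega, show k + 1 - (k - l + 2) = l - 1 by omega, hs,
        show k - (l - 1) = k + 1 - l by omega, mul_comm (j + 1), PowerSeries.coe_add,
        PowerSeries.coe_mul, PowerSeries.coe_pow]
      ring

end Gordon

theorem theorem4p1 (k : ℕ) (hk : 2 ≤ k) (j l : ℕ) (hl : 1 ≤ l) (hlk : l ≤ k) :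
    Gordon.G k ((k - 1) * j + l) =
      ((PowerSeries.mk fun m => (Gordon.numPartitions k j l m : ℂ) : ℂ⟦X⟧) : ℂ⸨X⸩) := by
  rw [Gordon.G_eq_partsGenFun hk j hl hlk, Gordon.partsGenFun]
  simp only [Gordon.numPartitions_eq_ncard hlk]
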